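/- **Setting.** A metric graph $\Gamma$ arises from a finite connected discrete graph (at least one edge; loops and parallel edges allowed) by identifying each edge $e$ with an interval $[0,L(e)]$, $L(e)\in(0,\infty)$, and is endowed with the path metric $\operatorname{dist}$ induced by the Euclidean metric on each edge; $\operatorname{diam}\Gamma=\max\{\operatorname{dist}(x,y):x,y\in\Gamma\}$. It is a metric tree if it contains no cycles. The Laplacian $-\Delta_\Gamma$ with standard vertex conditions acts in $L^2(\Gamma)$ as $f_e\mapsto -f_e''$ on each edge $e$, on the functions $f$ that are continuous on $\Gamma$, belong to $H^2(0,L(e))$ on each edge $e$, and satisfy the Kirchhoff condition that at each vertex the derivatives of $f$ along the incident edges, taken in the direction towards the vertex, sum up to zero. Its eigenvalues, counted with multiplicities, are $0=\mu_1(\Gamma)<\mu_2(\Gamma)\le\mu_3(\Gamma)\le\dots$; so $\mu_2(\Gamma)$ is the smallest positive eigenvalue. The set of global hot spots of $\Gamma$ is $$M=M(\Gamma)=\Big\{x\in\Gamma:\ \psi(x)=\max_{y\in\Gamma}\psi(y)\ \text{for some real eigenfunction } \psi\neq 0 \text{ of } -\Delta_\Gamma \text{ for the eigenvalue } \mu_2(\Gamma)\Big\}$$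 (since $-\psi$ is an eigenfunction if $\psi$ is, $M$ also contains the global minima of these eigenfunctions). **Proposition.** For each $\varepsilon>0$ there exists a metric tree $\Gamma$ with $\operatorname{diam}\Gamma=1$ such that $\mu_2(\Gamma)$ is simple (that is, its eigenspace is one-dimensional) and $$\max\{\operatorname{dist}(x,y): x,y\in M(\Gamma)\}<\varepsilon .$$ -/

import Mathlib

/-- `IsWalk o t u es v`: in the multigraph whose edges `e : E` have the end vertices `o e`, `t e`,
the list of edges `es`, each traversed in one of its two directions, is a walk from `u` to `v`. -/
inductive IsWalk {V E : Type} (o t : E → V) : V → List E → V → Prop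
  | nil (v : V) : IsWalk o t v [] v
  | fwd (e : E) (es : List E) (v : V) : IsWalk o t (t e) es v → IsWalk o t (o e) (e :: es) v
  | bwd (e : E) (es : List E) (v : V) : IsWalk o t (o e) es v → IsWalk o t (t e) (e :: es) v

/-- The data of a compact connected metric graph: a finite connected discrete graph (loops and
parallel edges allowed, at least one edge) with an arbitrary orientation of the edges
(`o e` is the originating, `t e` the terminal vertex of `e`) and a positive length for each edge. -/
structure MetricGraph where
  V : Type
  E : Type
  [fintypeV : Fintype V]
  [fintypeE : Fintype E]
  [nonemptyE : Nonempty E]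
  o : E → V
  t : E → V
  len : E → ℝ
  len_pos : ∀ e, 0 < len e
  connected : ∀ u v, ∃ es, IsWalk o t u es v

namespace MetricGraph

attribute [instance] fintypeV fintypeE nonemptyE

variable (Γ : MetricGraph)

/-- The graph is a tree: it is connected (part of `MetricGraph`) and has no cycles, that is, every
closed walk that repeats no edge is trivial. -/
def IsTree : Prop :=
  ∀ (v : Γ.V) (es : List Γ.E), IsWalk Γ.o Γ.t v es v → es.Nodup → es = []

/-- The points of the metric graph: the vertices, and the interior points `(e, x)`,
`0 < x < len e`, of the edges. -/
inductive Point : Type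
  | vertex (v : Γ.V) : Point
  | interior (e : Γ.E) (x : ℝ) (hx : x ∈ Set.Ioo 0 (Γ.len e)) : Point

open Classical in
/-- The identification of the interval `[0, len e]` with the closed edge `e`: the endpoint `0` is
the vertex `o e`, the endpoint `len e` is the vertex `t e`.
(Values for `x` outside `[0, len e]` are never used.) -/
noncomputable def pt (e : Γ.E) (x : ℝ) : Γ.Point :=
  if h : x ∈ Set.Ioo 0 (Γ.len e) then .interior e x h
  else if x ≤ 0 then .vertex (Γ.o e) else .vertex (Γ.t e)

/-- `Γ.Path p q ℓ`: one can get from `p` to `q` by finitely many moves, each of them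
inside one closed edge, of total length `ℓ`. -/
inductive Path : Γ.Point → Γ.Point → ℝ → Prop
  | refl (p : Γ.Point) : Path p p 0
  | step (e : Γ.E) (x y : ℝ) (q : Γ.Point) (ℓ : ℝ)
      (hx : x ∈ Set.Icc 0 (Γ.len e)) (hy : y ∈ Set.Icc 0 (Γ.len e)) :
      Path (Γ.pt e y) q ℓ → Path (Γ.pt e x) q (|x - y| + ℓ)

/-- The path metric on the metric graph, induced by the Euclidean metric on each edge. -/
protected noncomputable def dist (p q : Γ.Point) : ℝ :=
  sInf {ℓ : ℝ | Γ.Path p q ℓ}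

/-- The restriction `f_e` of a function on the graph to the edge `e ≅ [0, len e]`. -/
noncomputable def onEdge (f : Γ.Point → ℝ) (e : Γ.E) : ℝ → ℝ := fun x => f (Γ.pt e x)

/-- On the interval `[0, ℓ]`, the function `u` is (the continuous representative of) an element
of `H¹(0, ℓ)`, with weak derivative `w`: it is absolutely continuous, a primitive
of the function `w ∈ L²(0, ℓ)`. -/
def HasSobolevDeriv (ℓ : ℝ) (u w : ℝ → ℝ) : Prop :=
  MeasureTheory.MemLp w 2 (MeasureTheory.volume.restrict (Set.Ioo 0 ℓ)) ∧
    ∀ x ∈ Set.Icc 0 ℓ, u x = u 0 + ∫ s in (0 : ℝ)..x, w s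

open Classical in
/-- `f` belongs to the domain of the Laplacian `-Δ` with standard vertex conditions, and
`(-Δ f)_e = h e` on each edge: `f` is in `H²` on each edge, with derivative `g e` (the continuous
representative) and second derivative `-h e`; it is continuous at the vertices (automatic, as each
`f_e` is continuous on the closed edge and `f` is a function on the points of the graph);
and at each vertex the derivatives in the direction towards the vertex sum up to zero. -/
def HasLaplacian (f : Γ.Point → ℝ) (h : Γ.E → ℝ → ℝ) : Prop :=
  ∃ g : Γ.E → ℝ → ℝ,
    (∀ e, HasSobolevDeriv (Γ.len e) (Γ.onEdge f e) (g e)) ∧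
    (∀ e, HasSobolevDeriv (Γ.len e) (g e) (fun x => -h e x)) ∧
    ∀ v : Γ.V, (∑ e with Γ.t e = v, g e (Γ.len e)) - (∑ e with Γ.o e = v, g e 0) = 0

theorem HasSobolevDeriv.add {ℓ : ℝ} {u w u' w' : ℝ → ℝ}
    (h : HasSobolevDeriv ℓ u w) (h' : HasSobolevDeriv ℓ u' w') :
    HasSobolevDeriv ℓ (fun x => u x + u' x) (fun x => w x + w' x) := by
  refine ⟨h.1.add h'.1, fun x hx => ?_⟩
  have key : ∀ {z : ℝ → ℝ},
      MeasureTheory.MemLp z 2 (MeasureTheory.volume.restrict (Set.Ioo 0 ℓ)) →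
      IntervalIntegrable z MeasureTheory.volume 0 x := by
    intro z hz
    have h1 : MeasureTheory.IntegrableOn z (Set.Ioo 0 ℓ) := hz.integrable (by norm_num)
    rw [intervalIntegrable_iff_integrableOn_Ioo_of_le hx.1]
    exact h1.mono_set (Set.Ioo_subset_Ioo_right hx.2)
  beta_reduce
  rw [intervalIntegral.integral_add (key h.1) (key h'.1), h.2 x hx, h'.2 x hx]
  ring

theorem HasSobolevDeriv.const_mul {ℓ : ℝ} {u w : ℝ → ℝ} (c : ℝ) (h : HasSobolevDeriv ℓ u w) :
    HasSobolevDeriv ℓ (fun x => c * u x) (fun x => c * w x) := by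
  refine ⟨h.1.const_mul c, fun x hx => ?_⟩
  beta_reduce
  rw [intervalIntegral.integral_const_mul, h.2 x hx]
  ring

/-- The (real) eigenspace `ker (-Δ - μ)`, with eigenfunctions as functions on the graph. -/
noncomputable def eigenspace (μ : ℝ) : Submodule ℝ (Γ.Point → ℝ) where
  carrier := {f | Γ.HasLaplacian f (fun e x => μ * Γ.onEdge f e x)}
  zero_mem' := by
    refine ⟨fun _ _ => 0, fun e => ⟨?_, fun x _ => ?_⟩, fun e => ⟨?_, fun x _ => ?_⟩, fun v => ?_⟩
    all_goals simp [onEdge]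
  add_mem' := by
    rintro f f' ⟨g, h1, h2, h3⟩ ⟨g', h1', h2', h3'⟩
    refine ⟨fun e x => g e x + g' e x, fun e => (h1 e).add (h1' e), fun e => ?_, fun v => ?_⟩
    · convert (h2 e).add (h2' e) using 2 with x
      simp only [onEdge, Pi.add_apply]
      ring
    · simp only [Finset.sum_add_distrib]
      linarith [h3 v, h3' v]
  smul_mem' := by
    rintro c f ⟨g, h1, h2, h3⟩
    refine ⟨fun e x => c * g e x, fun e => (h1 e).const_mul c, fun e => ?_, fun v => ?_⟩
    · convert (h2 e).const_mul c using 2 with x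
      simp only [onEdge, Pi.smul_apply, smul_eq_mul]
      ring
    · simp only [← Finset.mul_sum]
      rw [← mul_sub, h3 v, mul_zero]

/-- `μ` is the second eigenvalue `μ₂` of the standard Laplacian (eigenvalues in increasing order
with multiplicities): as the graph is connected, `μ₁ = 0` is simple and
`μ₂` is the smallest positive eigenvalue. -/
def IsMu2 (μ : ℝ) : Prop := IsLeast {lam : ℝ | 0 < lam ∧ Γ.eigenspace lam ≠ ⊥} μ

/-- For `μ = μ₂`: the set `M` of global hot spots, the points at which some
eigenfunction for `μ₂` attains its global maximum (equivalently, on replacing the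
eigenfunction by its negative, its global minimum). -/
def hotSpots (μ : ℝ) : Set Γ.Point :=
  {x | ∃ ψ ∈ Γ.eigenspace μ, ψ ≠ 0 ∧ ∀ y, ψ y ≤ ψ x}

end MetricGraph

/-! ### Sobolev derivatives and the equation -u'' = ω²u on an interval. -/

open Set MeasureTheory

namespace MetricGraph

/-! A long tail fixes the diameter, while two short but heavy brooms at its other end carry the
second eigenfunction. Each broom has n² pendant edges of length 1/n on a neck of length 1/n, so its
total length is about n and it acts as a heavy mass on a spring. The lowest nonconstant mode moves
the two masses against each other, vanishes on the tail, and is extremal exactly at the leaves of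
the brooms, which are at most 4/n apart.

On such a tree an eigenfunction for ω² is determined by its value T at the tip of the tail and the
common value A s at the leaves of broom s (`exists_of_mem_eigenspace`). Put θ = ω/n, L = 1 - 2/n, K
= cos²θ - n² sin²θ and P = (1 + n²) sin θ cos θ. Continuity and the Kirchhoff condition at the
centre read T cos(ωL) = A s * K and T sin(ωL) + (A true + A false) P = 0. The factor K first
vanishes at tan θ = 1/n, that is, at ω = n arctan(1/n) ≤ 1, when still ωL < π/2. For smaller ω > 0
all coefficients are positive, apart from sin(ωL) ≥ 0, and there is no solution
(`eigenspace_eq_bot`); at this ω the solutions are T = 0, A false = -A true (`eigenspace_eq_span`).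
The hot spots are then found in `abs_mode_le_and`. -/

theorem HasSobolevDeriv.integrableOn_Icc {ℓ : ℝ} {u w : ℝ → ℝ} (h : HasSobolevDeriv ℓ u w) :
    IntegrableOn w (Icc 0 ℓ) := by
  rw [integrableOn_Icc_iff_integrableOn_Ioo]
  exact h.1.integrable (by norm_num)

theorem HasSobolevDeriv.continuousOn {ℓ : ℝ} (hℓ : 0 ≤ ℓ) {u w : ℝ → ℝ}
    (h : HasSobolevDeriv ℓ u w) : ContinuousOn u (Icc 0 ℓ) := by
  have h1 : ContinuousOn (fun x => ∫ s in (0 : ℝ)..x, w s) (uIcc 0 ℓ) :=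
    intervalIntegral.continuousOn_primitive_interval (by
      rw [uIcc_of_le hℓ]; exact h.integrableOn_Icc)
  rw [uIcc_of_le hℓ] at h1
  exact (continuousOn_const.add h1).congr h.2

/-- A function with a continuous Sobolev derivative extends to a differentiable function. -/
theorem HasSobolevDeriv.exists_hasDerivAt {ℓ : ℝ} (hℓ : 0 ≤ ℓ) {u w : ℝ → ℝ}
    (h : HasSobolevDeriv ℓ u w) (hw : ContinuousOn w (Icc 0 ℓ)) :
    ∃ U : ℝ → ℝ, (∀ x ∈ Icc 0 ℓ, U x = u x) ∧ ∀ x ∈ Icc 0 ℓ, HasDerivAt U (w x) x := by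
  -- Extending `w` by constants beyond the interval makes its primitive differentiable from both
  -- sides at the endpoints too.
  set w' : ℝ → ℝ := IccExtend hℓ ((Icc 0 ℓ).domRestrict w) with hw'
  have hc : Continuous w' := (continuousOn_iff_continuous_domRestrict.1 hw).Icc_extend'
  have he : ∀ x ∈ Icc 0 ℓ, w' x = w x := fun x hx => by
    rw [hw', IccExtend_of_mem _ _ hx]; rfl
  refine ⟨fun x => u 0 + ∫ s in (0 : ℝ)..x, w' s, fun x hx => ?_, fun x hx => ?_⟩
  · have : ∫ s in (0 : ℝ)..x, w' s = ∫ s in (0 : ℝ)..x, w s :=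
      intervalIntegral.integral_congr fun y hy => by
        rw [uIcc_of_le hx.1] at hy
        exact he y ⟨hy.1, hy.2.trans hx.2⟩
    simp only [h.2 x hx, this]
  · rw [← he x hx]
    exact (intervalIntegral.integral_hasDerivAt_right (hc.intervalIntegrable 0 x)
      (hc.stronglyMeasurableAtFilter volume _) hc.continuousAt).const_add (u 0)

/-- The `H²` solutions of `-u'' = ω² u` are the combinations of `cos` and `sin`. -/
theorem HasSobolevDeriv.eq_cos_sin {ℓ ω : ℝ} (hℓ : 0 ≤ ℓ) (hω : ω ≠ 0) {u w : ℝ → ℝ}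
    (h : HasSobolevDeriv ℓ u w) (h' : HasSobolevDeriv ℓ w (fun x => -(ω ^ 2 * u x))) :
    ∀ x ∈ Icc 0 ℓ, u x = u 0 * Real.cos (ω * x) + w 0 / ω * Real.sin (ω * x) ∧
      w x = ω * (-(u 0) * Real.sin (ω * x) + w 0 / ω * Real.cos (ω * x)) := by
  obtain ⟨U, hU, hU'⟩ := h.exists_hasDerivAt hℓ (h'.continuousOn hℓ)
  obtain ⟨W, hW, hW'⟩ := h'.exists_hasDerivAt hℓ
    ((continuousOn_const.mul (h.continuousOn hℓ)).neg)
  have hs : ∀ x : ℝ, HasDerivAt (fun x => Real.sin (ω * x)) (Real.cos (ω * x) * ω) x := fun x => by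
    simpa using ((hasDerivAt_id x).const_mul ω).sin
  have hc : ∀ x : ℝ, HasDerivAt (fun x => Real.cos (ω * x)) (-Real.sin (ω * x) * ω) x := fun x => by
    simpa using ((hasDerivAt_id x).const_mul ω).cos
  have hconst : ∀ F : ℝ → ℝ, (∀ x ∈ Icc 0 ℓ, HasDerivAt F 0 x) → ∀ x ∈ Icc 0 ℓ, F x = F 0 :=
    fun F hF => constant_of_has_deriv_right_zero
      (fun x hx => (hF x hx).continuousAt.continuousWithinAt)
      fun x hx => (hF x ⟨hx.1, hx.2.le⟩).hasDerivWithinAt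
  -- The phase vector (ωu, w) rotates with angular speed ω; turned back by the angle ωx, both its
  -- coordinates are constant.
  have hP := hconst (fun x => ω * U x * Real.cos (ω * x) - W x * Real.sin (ω * x)) fun x hx => by
    refine ((((hU' x hx).const_mul ω).mul (hc x)).sub ((hW' x hx).mul (hs x))).congr_deriv ?_
    rw [hU x hx, hW x hx]; ring
  have hQ := hconst (fun x => ω * U x * Real.sin (ω * x) + W x * Real.cos (ω * x)) fun x hx => by
    refine ((((hU' x hx).const_mul ω).mul (hs x)).add ((hW' x hx).mul (hc x))).congr_deriv ?_
    rw [hU x hx, hW x hx]; ring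
  intro x hx
  have h0 : (0 : ℝ) ∈ Icc 0 ℓ := ⟨le_rfl, hℓ⟩
  have e1 := hP x hx
  have e2 := hQ x hx
  simp only [hU x hx, hW x hx, hU 0 h0, hW 0 h0, mul_zero, Real.cos_zero, Real.sin_zero] at e1 e2
  have hsc := Real.sin_sq_add_cos_sq (ω * x)
  constructor
  · field_simp
    linear_combination (-ω * u x) * hsc + Real.cos (ω * x) * e1 + Real.sin (ω * x) * e2
  · field_simp
    linear_combination (- w x) * hsc - Real.sin (ω * x) * e1 + Real.cos (ω * x) * e2

theorem hasSobolevDeriv_of_hasDerivAt {ℓ : ℝ} (hℓ : 0 ≤ ℓ) {u w U W : ℝ → ℝ}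
    (hU : ∀ x, HasDerivAt U (W x) x) (hW : Continuous W)
    (hu : EqOn u U (Icc 0 ℓ)) (hw : EqOn w W (Icc 0 ℓ)) : HasSobolevDeriv ℓ u w := by
  refine ⟨?_, fun x hx => ?_⟩
  · have h1 : MemLp W 2 (volume.restrict (Icc 0 ℓ)) := by
      obtain ⟨C, hC⟩ := isCompact_Icc.exists_bound_of_continuousOn (s := Icc 0 ℓ) hW.continuousOn
      exact MemLp.of_bound hW.aestronglyMeasurable C
        ((ae_restrict_iff' measurableSet_Icc).2 (Filter.Eventually.of_forall hC))
    have h2 := h1.mono_measure (Measure.restrict_mono Ioo_subset_Icc_self le_rfl)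
    refine h2.ae_eq ?_
    exact (ae_restrict_iff' measurableSet_Ioo).2
      (Filter.Eventually.of_forall fun x hx => (hw (Ioo_subset_Icc_self hx)).symm)
  · have : ∫ s in (0 : ℝ)..x, w s = ∫ s in (0 : ℝ)..x, W s :=
      intervalIntegral.integral_congr fun y hy => by
        rw [uIcc_of_le hx.1] at hy
        exact hw ⟨hy.1, hy.2.trans hx.2⟩
    rw [this, intervalIntegral.integral_eq_sub_of_hasDerivAt (fun y _ => hU y)
      (hW.intervalIntegrable _ _), hu hx, hu ⟨le_rfl, hℓ⟩]
    ring

/-! ### Points on edges, gluing, and eigenfunctions as trigonometric functions. -/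

variable (Γ : MetricGraph)

theorem pt_zero (e : Γ.E) : Γ.pt e 0 = .vertex (Γ.o e) := by
  simp [pt]

theorem pt_len (e : Γ.E) : Γ.pt e (Γ.len e) = .vertex (Γ.t e) := by
  simp [pt, (Γ.len_pos e).not_ge]

theorem pt_of_mem_Ioo (e : Γ.E) {x : ℝ} (hx : x ∈ Ioo 0 (Γ.len e)) :
    Γ.pt e x = .interior e x hx := by
  rw [pt, dif_pos hx]

/-- The function on the graph given by its values at the vertices and along the edges. -/
def glue (a : Γ.V → ℝ) (F : Γ.E → ℝ → ℝ) : Γ.Point → ℝ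
  | .vertex v => a v
  | .interior e x _ => F e x

theorem glue_pt {a : Γ.V → ℝ} {F : Γ.E → ℝ → ℝ} (ho : ∀ e, F e 0 = a (Γ.o e))
    (ht : ∀ e, F e (Γ.len e) = a (Γ.t e)) (e : Γ.E) {x : ℝ} (hx : x ∈ Icc 0 (Γ.len e)) :
    Γ.glue a F (Γ.pt e x) = F e x := by
  rcases eq_endpoints_or_mem_Ioo_of_mem_Icc hx with h | h | h
  · rw [h, pt_zero, ho]; rfl
  · rw [h, pt_len, ht]; rfl
  · rw [pt_of_mem_Ioo Γ e h]; rfl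

open Classical in
/-- Eigenfunctions for `ω²` are trigonometric on each edge, and satisfy the Kirchhoff condition. -/
theorem mem_eigenspace_sq_iff {ω : ℝ} (hω : ω ≠ 0) (f : Γ.Point → ℝ) :
    f ∈ Γ.eigenspace (ω ^ 2) ↔ ∃ A B : Γ.E → ℝ,
      (∀ e, ∀ x ∈ Icc 0 (Γ.len e),
        f (Γ.pt e x) = A e * Real.cos (ω * x) + B e * Real.sin (ω * x)) ∧
      ∀ v : Γ.V, (∑ e with Γ.t e = v,
          (-A e * Real.sin (ω * Γ.len e) + B e * Real.cos (ω * Γ.len e))) -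
        ∑ e with Γ.o e = v, B e = 0 := by
  constructor
  · rintro ⟨g, h1, h2, h3⟩
    have key := fun e => (h1 e).eq_cos_sin (Γ.len_pos e).le hω (h2 e)
    refine ⟨fun e => Γ.onEdge f e 0, fun e => g e 0 / ω, fun e x hx => (key e x hx).1, fun v => ?_⟩
    have := h3 v
    rw [Finset.sum_congr rfl fun e _ => (key e _ ⟨(Γ.len_pos e).le, le_rfl⟩).2,
      ← Finset.mul_sum] at this
    rw [← Finset.sum_div, ← mul_right_inj' hω, mul_sub, mul_div_cancel₀ _ hω, this, mul_zero]
  · rintro ⟨A, B, hf, hK⟩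
    have hs : ∀ x : ℝ, HasDerivAt (fun x => Real.sin (ω * x)) (Real.cos (ω * x) * ω) x := fun x => by
      simpa using ((hasDerivAt_id x).const_mul ω).sin
    have hc : ∀ x : ℝ, HasDerivAt (fun x => Real.cos (ω * x)) (-Real.sin (ω * x) * ω) x :=
      fun x => by simpa using ((hasDerivAt_id x).const_mul ω).cos
    refine ⟨fun e x => ω * (-A e * Real.sin (ω * x) + B e * Real.cos (ω * x)), fun e => ?_,
      fun e => ?_, fun v => ?_⟩
    · refine hasSobolevDeriv_of_hasDerivAt (Γ.len_pos e).le
        (U := fun x => A e * Real.cos (ω * x) + B e * Real.sin (ω * x)) (fun x => ?_)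
        (by fun_prop) (fun x hx => hf e x hx) fun x _ => rfl
      refine (((hc x).const_mul (A e)).add ((hs x).const_mul (B e))).congr_deriv ?_
      ring
    · refine hasSobolevDeriv_of_hasDerivAt (Γ.len_pos e).le
        (W := fun x => -(ω ^ 2 * (A e * Real.cos (ω * x) + B e * Real.sin (ω * x)))) (fun x => ?_)
        (by fun_prop) (fun x _ => rfl) fun x hx => by simp only [onEdge, hf e x hx]
      refine ((((hs x).const_mul (-A e)).add ((hc x).const_mul (B e))).const_mul ω).congr_deriv ?_
      ring
    · simp only [← Finset.mul_sum]
      simp only [mul_zero, Real.sin_zero, Real.cos_zero, mul_one, zero_add]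
      rw [← mul_sub, hK v, mul_zero]

/-! ### Path lengths and a criterion for trees. -/

variable {Γ}

theorem Path.trans {p q r : Γ.Point} {k l : ℝ} (h : Γ.Path p q k) (h' : Γ.Path q r l) :
    Γ.Path p r (k + l) := by
  induction h with
  | refl => simpa using h'
  | step e x y q m hx hy _ ih => rw [add_assoc]; exact .step e x y _ _ hx hy (ih h')

theorem Path.of_edge (e : Γ.E) {x y : ℝ} (hx : x ∈ Icc 0 (Γ.len e)) (hy : y ∈ Icc 0 (Γ.len e)) :
    Γ.Path (Γ.pt e x) (Γ.pt e y) |x - y| := by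
  simpa using Path.step e x y _ 0 hx hy (.refl _)

theorem Path.symm {p q : Γ.Point} {k : ℝ} (h : Γ.Path p q k) : Γ.Path q p k := by
  induction h with
  | refl => exact .refl _
  | step e x y q m hx hy _ ih =>
    rw [add_comm, abs_sub_comm]
    exact ih.trans (.of_edge e hy hx)

theorem Path.nonneg {p q : Γ.Point} {k : ℝ} (h : Γ.Path p q k) : 0 ≤ k := by
  induction h with
  | refl => exact le_rfl
  | step e x y q m hx hy _ ih => positivity

theorem Path.dist_le {p q : Γ.Point} {k : ℝ} (h : Γ.Path p q k) : Γ.dist p q ≤ k :=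
  csInf_le ⟨0, fun _ h => Path.nonneg h⟩ h

/-- A function that is 1-Lipschitz on each edge gains at most the length of a path along it; this
provides lower bounds for distances. -/
theorem Path.sub_le {φ : Γ.Point → ℝ}
    (hφ : ∀ e, ∀ x ∈ Icc 0 (Γ.len e), ∀ y ∈ Icc 0 (Γ.len e),
      φ (Γ.pt e x) - φ (Γ.pt e y) ≤ |x - y|)
    {p q : Γ.Point} {k : ℝ} (h : Γ.Path p q k) : φ p - φ q ≤ k := by
  induction h with
  | refl => simp
  | step e x y q m hx hy _ ih => linarith [hφ e x hx y hy]

/-- If every edge is a bridge, there are no cycles: after its first edge, a closed walk without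
repetition would have to return across the cut χ without using the only edge that crosses it. -/
theorem isTree_of_cut (h : ∀ e : Γ.E, ∃ χ : Γ.V → Prop, ¬(χ (Γ.o e) ↔ χ (Γ.t e)) ∧
    ∀ e', e' ≠ e → (χ (Γ.o e') ↔ χ (Γ.t e'))) : Γ.IsTree := by
  have key : ∀ (e : Γ.E) (χ : Γ.V → Prop), (∀ e', e' ≠ e → (χ (Γ.o e') ↔ χ (Γ.t e'))) →
      ∀ (u v : Γ.V) (es : List Γ.E), IsWalk Γ.o Γ.t u es v → e ∉ es → (χ u ↔ χ v) := by
    intro e χ hχ u v es hw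
    induction hw with
    | nil => intro _; rfl
    | fwd e' es v _ ih =>
      intro hn
      rw [List.mem_cons, not_or] at hn
      exact (hχ e' (Ne.symm hn.1)).trans (ih hn.2)
    | bwd e' es v _ ih =>
      intro hn
      rw [List.mem_cons, not_or] at hn
      exact (hχ e' (Ne.symm hn.1)).symm.trans (ih hn.2)
  intro v es hw hnd
  cases hw with
  | nil => rfl
  | fwd e es _ hw =>
    obtain ⟨χ, h1, h2⟩ := h e
    exact absurd (key e χ h2 _ _ es hw (List.nodup_cons.1 hnd).1).symm h1
  | bwd e es _ hw =>
    obtain ⟨χ, h1, h2⟩ := h e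
    exact absurd (key e χ h2 _ _ es hw (List.nodup_cons.1 hnd).1) h1

end MetricGraph

/-! ### Combinatorics of the double broom. -/

theorem IsWalk.append {V E : Type} {o t : E → V} {u v w : V} {es fs : List E}
    (h : IsWalk o t u es v) (h' : IsWalk o t v fs w) : IsWalk o t u (es ++ fs) w := by
  induction h with
  | nil => exact h'
  | fwd e es v _ ih => exact .fwd e _ _ (ih h')
  | bwd e es v _ ih => exact .bwd e _ _ (ih h')

/-- The edges of the tree below, each identified with its endpoint away from the centre: the tail,
for each `s : Bool` a neck, and on top of each neck `n ^ 2` pendant edges. -/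
abbrev BroomEdge (n : ℕ) : Type := Option (Bool × Option (Fin (n ^ 2)))

namespace BroomEdge

/-- The endpoint of an edge nearer to the centre `none`. -/
def parent {n : ℕ} : BroomEdge n → Option (BroomEdge n)
  | none => none
  | some (_, none) => none
  | some (s, some _) => some (some (s, none))

theorem parent_none {n : ℕ} : parent (none : BroomEdge n) = none := rfl

theorem parent_neck {n : ℕ} (s : Bool) : parent (some (s, none) : BroomEdge n) = none := rfl

theorem parent_pendant {n : ℕ} (s : Bool) (i : Fin (n ^ 2)) :
    parent (some (s, some i)) = some (some (s, none)) := rfl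

/-- The length of an edge. -/
noncomputable def length {n : ℕ} : BroomEdge n → ℝ
  | none => 1 - 2 / n
  | some _ => 1 / n

theorem length_pos {n : ℕ} (hn : 5 ≤ n) (e : BroomEdge n) : 0 < e.length := by
  have h : (5 : ℝ) ≤ n := by exact_mod_cast hn
  rcases e with _ | e
  · have : (2 : ℝ) / n < 1 := by rw [div_lt_one (by linarith)]; linarith
    simpa [length] using this
  · simp only [length]; positivity

theorem isWalk_root {n : ℕ} (v : Option (BroomEdge n)) :
    ∃ es, IsWalk some parent v es none := by
  rcases v with _ | _ | ⟨s, _ | i⟩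
  · exact ⟨_, .nil _⟩
  · exact ⟨_, .fwd none _ _ (.nil _)⟩
  · exact ⟨_, .fwd (some (s, none)) _ _ (.nil _)⟩
  · exact ⟨_, .fwd (some (s, some i)) _ _ (.fwd (some (s, none)) _ _ (.nil _))⟩

theorem root_isWalk {n : ℕ} (v : Option (BroomEdge n)) :
    ∃ es, IsWalk some parent none es v := by
  rcases v with _ | _ | ⟨s, _ | i⟩
  · exact ⟨_, .nil _⟩
  · exact ⟨_, .bwd none _ _ (.nil _)⟩
  · exact ⟨_, .bwd (some (s, none)) _ _ (.nil _)⟩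
  · exact ⟨_, .bwd (some (s, none)) _ _ (.bwd (some (s, some i)) _ _ (.nil _))⟩

/-- The Kirchhoff conditions, vertex by vertex: the centre, the tip of the tail, the tops of the
necks, the leaves. `F` stands for the derivatives at the ends towards the centre, `G` for those at
the far ends. -/
theorem sum_parent_sub_sum_eq_zero_iff {n : ℕ} (F G : BroomEdge n → ℝ) :
    (∀ v, (∑ e with parent e = v, F e) - ∑ e with some e = v, G e = 0) ↔
      F none + F (some (true, none)) + F (some (false, none)) = 0 ∧ G none = 0 ∧
      (∀ s, ∑ i, F (some (s, some i)) = G (some (s, none))) ∧ ∀ s i, G (some (s, some i)) = 0 := by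
  have h1 : ∀ e, ∑ e' with some e' = some e, G e' = G e := fun e => by
    rw [Finset.sum_filter, Finset.sum_eq_single e] <;> simp +contextual
  have h2 : ∑ e' with some e' = (none : Option (BroomEdge n)), G e' = 0 := by simp
  have h3 : ∑ e with parent e = (none : Option (BroomEdge n)), F e =
      F none + F (some (true, none)) + F (some (false, none)) := by
    simp only [Finset.sum_filter, Fintype.sum_option, Fintype.sum_prod_type, Fintype.sum_bool,
      parent_none, parent_neck, parent_pendant]
    simp [add_assoc]
  have h4 : ∑ e with parent e = some (none : BroomEdge n), F e = 0 := by
    simp only [Finset.sum_filter, Fintype.sum_option, Fintype.sum_prod_type, Fintype.sum_bool,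
      parent_none, parent_neck, parent_pendant]
    simp
  have h5 : ∀ s, ∑ e with parent e = some (some (s, none) : BroomEdge n), F e =
      ∑ i, F (some (s, some i)) := by
    intro s
    simp only [Finset.sum_filter, Fintype.sum_option, Fintype.sum_prod_type, Fintype.sum_bool,
      parent_none, parent_neck, parent_pendant]
    cases s <;> simp
  have h6 : ∀ s i, ∑ e with parent e = some (some (s, some i) : BroomEdge n), F e = 0 := by
    intro s i
    simp only [Finset.sum_filter, Fintype.sum_option, Fintype.sum_prod_type, Fintype.sum_bool,
      parent_none, parent_neck, parent_pendant]
    simp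
  constructor
  · intro h
    refine ⟨?_, ?_, fun s => ?_, fun s i => ?_⟩
    · simpa only [h3, h2, sub_zero] using h none
    · simpa only [h4, h1, zero_sub, neg_eq_zero] using h (some none)
    · simpa only [h5, h1, sub_eq_zero] using h (some (some (s, none)))
    · simpa only [h6, h1, zero_sub, neg_eq_zero] using h (some (some (s, some i)))
  · rintro ⟨k1, k2, k3, k4⟩ (_ | _ | ⟨s, _ | i⟩)
    · rw [h3, h2, k1, sub_zero]
    · rw [h4, h1, k2, sub_zero]
    · rw [h5, h1, k3, sub_self]
    · rw [h6, h1, k4, sub_zero]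

end BroomEdge

open BroomEdge

/-- Two brooms with `n ^ 2` pendant edges of length `1 / n` each, joined by two necks of length
`1 / n` at a centre to which a tail of length `1 - 2 / n` is attached. -/
noncomputable abbrev doubleBroom (n : ℕ) (hn : 5 ≤ n) : MetricGraph where
  V := Option (BroomEdge n)
  E := BroomEdge n
  o := some
  t := parent
  len := BroomEdge.length
  len_pos := length_pos hn
  connected u v := by
    obtain ⟨es, h⟩ := isWalk_root u
    obtain ⟨fs, h'⟩ := root_isWalk v
    exact ⟨_, h.append h'⟩

/-! ### Tree property, distances and diameter of the double broom. -/

namespace doubleBroom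

variable {n : ℕ} (hn : 5 ≤ n)

theorem isTree : (doubleBroom n hn).IsTree := by
  refine MetricGraph.isTree_of_cut ?_
  rintro (_ | ⟨s, _ | i⟩)
  · refine ⟨fun v => v = some none, by simp [parent], ?_⟩
    rintro (_ | ⟨s', _ | j⟩) h <;> simp_all [parent]
  -- Here `j` ranges over an `Option`: the set consists of the top of the neck and all leaves above
  -- it.
  · refine ⟨fun v => ∃ j, v = some (some (s, j)), by simp [parent], ?_⟩
    rintro (_ | ⟨s', _ | j⟩) h <;> simp_all [parent]
  · refine ⟨fun v => v = some (some (s, some i)), by simp [parent], ?_⟩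
    rintro (_ | ⟨s', _ | j⟩) h <;> simp_all [parent]

theorem exists_pt_eq (p : (doubleBroom n hn).Point) :
    ∃ (e : BroomEdge n) (x : ℝ), x ∈ Icc 0 e.length ∧ p = (doubleBroom n hn).pt e x := by
  rcases p with (_ | e) | ⟨e, x, hx⟩
  · exact ⟨none, _, ⟨(length_pos hn none).le, le_rfl⟩,
      ((doubleBroom n hn).pt_len none).symm⟩
  · exact ⟨e, 0, ⟨le_rfl, (length_pos hn e).le⟩, ((doubleBroom n hn).pt_zero e).symm⟩
  · exact ⟨e, x, Ioo_subset_Icc_self hx, ((doubleBroom n hn).pt_of_mem_Ioo e hx).symm⟩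

theorem path_root (e : BroomEdge n) {x : ℝ} (hx : x ∈ Icc 0 e.length) :
    ∃ h, (doubleBroom n hn).Path ((doubleBroom n hn).pt e x) (.vertex none) h ∧
      (e = none → h ≤ 1 - 2 / n) ∧ (e ≠ none → h ≤ 2 / n) := by
  have hl : ∀ e' : BroomEdge n, e'.length ∈ Icc 0 e'.length :=
    fun e' => ⟨(length_pos hn e').le, le_rfl⟩
  have h0 : ∀ e' : BroomEdge n, (0 : ℝ) ∈ Icc 0 e'.length :=
    fun e' => ⟨le_rfl, (length_pos hn e').le⟩
  have h1 := MetricGraph.Path.of_edge (Γ := doubleBroom n hn) e hx (hl e)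
  rw [MetricGraph.pt_len, abs_sub_comm, abs_of_nonneg (sub_nonneg.2 hx.2)] at h1
  rcases e with _ | ⟨s, _ | i⟩
  · refine ⟨_, h1, fun _ => ?_, by simp⟩
    have := hx.1
    simp only [BroomEdge.length] at this ⊢
    linarith
  · refine ⟨_, h1, by simp, fun _ => ?_⟩
    have := hx.1
    have : (0 : ℝ) ≤ 1 / n := by positivity
    simp only [BroomEdge.length, show (2 : ℝ) / n = 1 / n + 1 / n by ring] at this ⊢
    linarith
  · have h2 := MetricGraph.Path.of_edge (Γ := doubleBroom n hn) (some (s, none)) (h0 (some (s, none)))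
      (hl (some (s, none)))
    rw [MetricGraph.pt_len, MetricGraph.pt_zero] at h2
    refine ⟨_, h1.trans h2, by simp, fun _ => ?_⟩
    have := hx.1
    have h3 : (0 : ℝ) ≤ 1 / n := by positivity
    simp only [BroomEdge.length, show (2 : ℝ) / n = 1 / n + 1 / n by ring, zero_sub, abs_neg,
      abs_of_nonneg h3] at this ⊢
    linarith

theorem dist_le_four_div {e e' : BroomEdge n} (he : e ≠ none) (he' : e' ≠ none) {x y : ℝ}
    (hx : x ∈ Icc 0 e.length) (hy : y ∈ Icc 0 e'.length) :
    (doubleBroom n hn).dist ((doubleBroom n hn).pt e x) ((doubleBroom n hn).pt e' y) ≤ 4 / n := by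
  obtain ⟨h, h1, -, h2⟩ := path_root hn e hx
  obtain ⟨k, k1, -, k2⟩ := path_root hn e' hy
  have := (h1.trans k1.symm).dist_le
  have h3 : (4 : ℝ) / n = 2 / n + 2 / n := by ring
  linarith [h2 he, k2 he']

theorem dist_le_one (p q : (doubleBroom n hn).Point) : (doubleBroom n hn).dist p q ≤ 1 := by
  obtain ⟨e, x, hx, rfl⟩ := exists_pt_eq hn p
  obtain ⟨e', y, hy, rfl⟩ := exists_pt_eq hn q
  have hn' : (5 : ℝ) ≤ n := by exact_mod_cast hn
  by_cases he : e = none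
  · by_cases he' : e' = none
    · subst he he'
      refine (MetricGraph.Path.of_edge _ hx hy).dist_le.trans ?_
      have h2 : (0 : ℝ) ≤ 2 / n := by positivity
      simp only [BroomEdge.length] at hx hy
      rw [abs_le]
      constructor <;> linarith [hx.1, hx.2, hy.1, hy.2]
    · obtain ⟨h, h1, h2, -⟩ := path_root hn e hx
      obtain ⟨k, k1, -, k2⟩ := path_root hn e' hy
      linarith [h2 he, k2 he', (h1.trans k1.symm).dist_le]
  · by_cases he' : e' = none
    · obtain ⟨h, h1, -, h2⟩ := path_root hn e hx
      obtain ⟨k, k1, k2, -⟩ := path_root hn e' hy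
      linarith [h2 he, k2 he', (h1.trans k1.symm).dist_le]
    · refine (dist_le_four_div hn he he' hx hy).trans ?_
      rw [div_le_one] <;> linarith

/-- The values at the vertices of the function which is the distance to the centre along the
tail, and its negative on the brooms. -/
noncomputable def vertexHeight : Option (BroomEdge n) → ℝ
  | none => 0
  | some none => 1 - 2 / n
  | some (some (_, none)) => -(1 / n)
  | some (some (_, some _)) => -(2 / n)

/-- The values along the edges of the function which is the distance to the centre along the
tail, and its negative on the brooms. -/
noncomputable def edgeHeight : BroomEdge n → ℝ → ℝ
  | none, x => 1 - 2 / n - x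
  | some (_, none), x => x - 1 / n
  | some (_, some _), x => x - 2 / n

theorem glue_height_sub_le (e : BroomEdge n) (x : ℝ) (hx : x ∈ Icc 0 e.length) (y : ℝ)
    (hy : y ∈ Icc 0 e.length) :
    (doubleBroom n hn).glue vertexHeight edgeHeight ((doubleBroom n hn).pt e x) -
      (doubleBroom n hn).glue vertexHeight edgeHeight ((doubleBroom n hn).pt e y) ≤ |x - y| := by
  have ho : ∀ e : BroomEdge n, edgeHeight e 0 = vertexHeight (some e) := by
    rintro (_ | ⟨s, _ | i⟩) <;> simp [edgeHeight, vertexHeight]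
  have ht : ∀ e : BroomEdge n, edgeHeight e e.length = vertexHeight e.parent := by
    rintro (_ | ⟨s, _ | i⟩) <;> simp only [edgeHeight, vertexHeight, BroomEdge.length, parent] <;>
      ring
  rw [MetricGraph.glue_pt (doubleBroom n hn) ho ht e hx,
    MetricGraph.glue_pt (doubleBroom n hn) ho ht e hy]
  rcases e with _ | ⟨s, _ | i⟩ <;> simp only [edgeHeight]
  · linarith [neg_le_abs (x - y)]
  · linarith [le_abs_self (x - y)]
  · linarith [le_abs_self (x - y)]

/-- The signed height is 1-Lipschitz and falls from 1 - 2/n at the tip of the tail to -2/n at a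
leaf. -/
theorem one_le_dist (i : Fin (n ^ 2)) :
    1 ≤ (doubleBroom n hn).dist (.vertex (some none))
      (.vertex (some (some (true, some i)))) := by
  obtain ⟨h, h1, -⟩ := path_root hn none (x := 0) ⟨le_rfl, (length_pos hn _).le⟩
  obtain ⟨k, k1, -⟩ := path_root hn (some (true, some i)) (x := 0) ⟨le_rfl, (length_pos hn _).le⟩
  rw [MetricGraph.pt_zero] at h1 k1
  refine le_csInf ⟨_, h1.trans k1.symm⟩ fun l hl => ?_
  have := hl.sub_le (glue_height_sub_le hn)
  simp only [MetricGraph.glue, vertexHeight] at this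
  linarith

theorem isGreatest_dist :
    IsGreatest {d : ℝ | ∃ x y : (doubleBroom n hn).Point, d = (doubleBroom n hn).dist x y} 1 := by
  have : NeZero (n ^ 2) := ⟨by positivity⟩
  refine ⟨⟨_, _, le_antisymm (one_le_dist hn 0) (dist_le_one hn _ _)⟩, ?_⟩
  rintro _ ⟨x, y, rfl⟩
  exact dist_le_one hn x y

/-! ### Reduction of the eigenvalue problem to three unknowns. -/

open Real in
theorem exists_of_mem_eigenspace {ω : ℝ} (hω : ω ≠ 0) (hc : cos (ω * (1 / n)) ≠ 0)
    {f : (doubleBroom n hn).Point → ℝ} (hf : f ∈ (doubleBroom n hn).eigenspace (ω ^ 2)) :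
    ∃ (T : ℝ) (A : Bool → ℝ),
      (∀ x ∈ Icc 0 (BroomEdge.length (none : BroomEdge n)),
        f ((doubleBroom n hn).pt none x) = T * cos (ω * x)) ∧
      (∀ s, ∀ x ∈ Icc (0 : ℝ) (1 / n), f ((doubleBroom n hn).pt (some (s, none)) x) =
        A s * (cos (ω * (1 / n)) * cos (ω * x) - n ^ 2 * sin (ω * (1 / n)) * sin (ω * x))) ∧
      (∀ s i, ∀ x ∈ Icc (0 : ℝ) (1 / n), f ((doubleBroom n hn).pt (some (s, some i)) x) =
        A s * cos (ω * x)) ∧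
      (∀ s, T * cos (ω * (1 - 2 / n)) =
        A s * (cos (ω * (1 / n)) ^ 2 - n ^ 2 * sin (ω * (1 / n)) ^ 2)) ∧
      T * sin (ω * (1 - 2 / n)) +
        (A true + A false) * (sin (ω * (1 / n)) * cos (ω * (1 / n)) * (1 + n ^ 2)) = 0 := by
  rw [MetricGraph.mem_eigenspace_sq_iff _ hω] at hf
  obtain ⟨A, B, hf, hK⟩ := hf
  have hl : ∀ e : BroomEdge n, e.length ∈ Icc 0 e.length :=
    fun e' => ⟨(length_pos hn e').le, le_rfl⟩
  have h0 : ∀ e : BroomEdge n, (0 : ℝ) ∈ Icc 0 e.length :=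
    fun e' => ⟨le_rfl, (length_pos hn e').le⟩
  have hv0 : ∀ e : BroomEdge n, f (.vertex (some e)) = A e := fun e => by
    have := hf e 0 (h0 e)
    rw [MetricGraph.pt_zero] at this
    simpa using this
  have hv1 : ∀ e : BroomEdge n, f (.vertex e.parent) =
      A e * cos (ω * e.length) + B e * sin (ω * e.length) := fun e => by
    have := hf e _ (hl e)
    rwa [MetricGraph.pt_len] at this
  obtain ⟨K0, K1, K2, K3⟩ := (sum_parent_sub_sum_eq_zero_iff
    (fun e => -A e * sin (ω * e.length) + B e * cos (ω * e.length)) B).1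
    fun v => by convert hK v
  simp only [BroomEdge.length] at K0 K2
  -- The value at the top of the neck is divided by cos(ω/n): by continuity there and the Neumann
  -- condition at the leaves, `a s` is the value at every leaf of broom `s`.
  obtain ⟨a, ha⟩ : ∃ a : Bool → ℝ, ∀ s, A (some (s, none)) = a s * cos (ω * (1 / n)) :=
    ⟨fun s => A (some (s, none)) / cos (ω * (1 / n)), fun s => (div_mul_cancel₀ _ hc).symm⟩
  have hA : ∀ s i, A (some (s, some i)) = a s := fun s i => by
    have := hv1 (some (s, some i))
    simp only [K3, parent, hv0, BroomEdge.length, ha, zero_mul, add_zero] at this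
    exact (mul_right_cancel₀ hc this).symm
  have hB : ∀ s, B (some (s, none)) = -(a s * n ^ 2 * sin (ω * (1 / n))) := fun s => by
    rw [← K2 s]
    simp only [K3, hA, zero_mul, add_zero, Finset.sum_const, Finset.card_univ, Fintype.card_fin,
      nsmul_eq_mul, Nat.cast_pow]
    ring
  have hr : ∀ e : BroomEdge n, e.parent = none →
      A e * cos (ω * e.length) + B e * sin (ω * e.length) = f (.vertex none) := fun e he => by
    rw [← he, hv1]
  have hr0 := hr none rfl
  have hr1 := fun s => hr (some (s, none)) rfl
  simp only [BroomEdge.length, K1, hB, ha] at hr0 hr1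
  refine ⟨A none, a, fun x hx => ?_, fun s x hx => ?_, fun s i x hx => ?_, fun s => ?_, ?_⟩
  · rw [hf none x hx, K1]; ring
  · rw [hf (some (s, none)) x hx, hB, ha]; ring
  · rw [hf (some (s, some i)) x hx, K3, hA, zero_mul, add_zero]
  · linear_combination hr0 - hr1 s
  · rw [K1, hB, hB, ha, ha] at K0
    linear_combination -K0

end doubleBroom

/-! ### The second frequency and its antisymmetric eigenfunction. -/

namespace doubleBroom

variable {n : ℕ} (hn : 5 ≤ n)

open Real

/-- The square root of the second eigenvalue of `doubleBroom n hn`. -/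
noncomputable def frequency (n : ℕ) : ℝ := n * arctan (1 / n)

theorem frequency_mul (hn : 5 ≤ n) : frequency n * (1 / n) = arctan (1 / n) := by
  have : (n : ℝ) ≠ 0 := by positivity
  rw [frequency]; field_simp

theorem frequency_pos (hn : 5 ≤ n) : 0 < frequency n := by
  have : (0 : ℝ) < n := by positivity
  have : 0 < arctan (1 / (n : ℝ)) := by rw [arctan_pos]; positivity
  rw [frequency]; positivity

theorem frequency_le_one (hn : 5 ≤ n) : frequency n ≤ 1 := by
  have h0 : (0 : ℝ) < n := by positivity
  have h : arctan (1 / (n : ℝ)) ≤ 1 / n := by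
    have := le_tan (arctan_nonneg.2 (by positivity)) (arctan_lt_pi_div_two (1 / (n : ℝ)))
    rwa [tan_arctan] at this
  calc frequency n ≤ n * (1 / n) := by rw [frequency]; gcongr
    _ = 1 := by field_simp

theorem cos_pos_of_le_frequency (hn : 5 ≤ n) {ω x : ℝ} (hω : 0 ≤ ω) (h : ω ≤ frequency n) (hx : 0 ≤ x)
    (hx1 : x ≤ 1) : 0 < cos (ω * x) := by
  have h1 := frequency_le_one hn
  have h2 : ω * x ≤ 1 := by nlinarith
  exact cos_pos_of_mem_Ioo ⟨by nlinarith [pi_gt_three], by linarith [pi_gt_three]⟩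

/-- This is tan θ = 1/n, the condition for K to vanish, so that the neck function is zero at the
centre. -/
theorem cos_arctan_eq (hn : 5 ≤ n) : cos (arctan (1 / n)) = n * sin (arctan (1 / (n : ℝ))) := by
  have h0 : (n : ℝ) ≠ 0 := by positivity
  have h := tan_arctan (1 / (n : ℝ))
  rw [tan_eq_sin_div_cos, div_eq_div_iff (cos_arctan_pos _).ne' h0] at h
  linarith

/-- The coefficients of `cos` in the eigenfunction `mode`. -/
noncomputable def cosCoeff : BroomEdge n → ℝ
  | none => 0
  | some (s, none) => (if s then 1 else -1) * cos (arctan (1 / n))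
  | some (s, some _) => if s then 1 else -1

/-- The coefficients of `sin` in the eigenfunction `mode`. -/
noncomputable def sinCoeff : BroomEdge n → ℝ
  | none => 0
  | some (s, none) => -((if s then 1 else -1) * n ^ 2 * sin (arctan (1 / n)))
  | some (_, some _) => 0

/-- The eigenfunction for the second eigenvalue. -/
noncomputable def mode : (doubleBroom n hn).Point → ℝ :=
  (doubleBroom n hn).glue (fun v => v.elim 0 cosCoeff)
    fun e x => cosCoeff e * cos (frequency n * x) + sinCoeff e * sin (frequency n * x)

theorem mode_pt (e : BroomEdge n) {x : ℝ} (hx : x ∈ Icc 0 e.length) :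
    mode hn ((doubleBroom n hn).pt e x) =
      cosCoeff e * cos (frequency n * x) + sinCoeff e * sin (frequency n * x) := by
  refine MetricGraph.glue_pt (doubleBroom n hn) (F := fun e x =>
    cosCoeff e * cos (frequency n * x) + sinCoeff e * sin (frequency n * x))
    (a := fun v => v.elim 0 cosCoeff) (fun e => ?_) (fun e => ?_) e hx
  · simp
  · rcases e with _ | ⟨s, _ | i⟩
    · simp [cosCoeff, sinCoeff, parent]
    · simp only [BroomEdge.length, frequency_mul hn, cosCoeff, sinCoeff, parent,
        Option.elim_none, cos_arctan_eq hn]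
      ring
    · simp only [BroomEdge.length, frequency_mul hn, cosCoeff, sinCoeff, parent,
        Option.elim_some]
      ring

theorem mode_mem_eigenspace : mode hn ∈ (doubleBroom n hn).eigenspace (frequency n ^ 2) := by
  rw [MetricGraph.mem_eigenspace_sq_iff _ (frequency_pos hn).ne']
  refine ⟨cosCoeff, sinCoeff, fun e x hx => mode_pt hn e hx, fun v => ?_⟩
  have := (sum_parent_sub_sum_eq_zero_iff
    (fun e : BroomEdge n => -cosCoeff e * sin (frequency n * e.length) +
      sinCoeff e * cos (frequency n * e.length)) sinCoeff).2 ?_ v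
  · convert this
  simp only [BroomEdge.length, frequency_mul hn, cosCoeff, sinCoeff]
  refine ⟨?_, trivial, fun s => ?_, fun _ _ => trivial⟩
  · simp only [Bool.false_eq_true, if_true, if_false]; ring
  · simp only [zero_mul, add_zero, Finset.sum_const, Finset.card_univ, Fintype.card_fin,
      nsmul_eq_mul, Nat.cast_pow]
    ring

/-! ### No smaller positive eigenvalue, and simplicity. -/

theorem eigenspace_eq_bot {ω : ℝ} (hω : 0 < ω) (h : ω < frequency n) :
    (doubleBroom n hn).eigenspace (ω ^ 2) = ⊥ := by
  have h5 : (5 : ℝ) ≤ n := by exact_mod_cast hn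
  have h0 : (0 : ℝ) < n := by linarith
  have hd : (2 : ℝ) / n ≤ 1 := by rw [div_le_one] <;> linarith
  have hd1 : (1 : ℝ) / n ≤ 1 := by rw [div_le_one] <;> linarith
  have hc := cos_pos_of_le_frequency hn hω.le h.le (x := 1 / n) (by positivity) hd1
  have hL0 : 0 ≤ 1 - (2 : ℝ) / n := by linarith
  have hL1 : 1 - (2 : ℝ) / n ≤ 1 := by linarith [show (0 : ℝ) ≤ 2 / n by positivity]
  have hcL := cos_pos_of_le_frequency hn hω.le h.le hL0 hL1
  have hf1 := frequency_le_one hn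
  have hsL : 0 ≤ sin (ω * (1 - 2 / n)) :=
    sin_nonneg_of_nonneg_of_le_pi (by positivity) (by nlinarith [pi_gt_three])
  have hθ : ω * (1 / n) < arctan (1 / n) := by
    rw [← frequency_mul hn]; gcongr
  have hs : 0 < sin (ω * (1 / n)) :=
    sin_pos_of_pos_of_lt_pi (by positivity)
      (by linarith [arctan_lt_pi_div_two (1 / n), pi_gt_three])
  have htan : tan (ω * (1 / n)) < 1 / n := by
    have := tan_lt_tan_of_lt_of_lt_pi_div_two (by
      have : 0 < ω * (1 / n) := by positivity
      linarith [pi_gt_three]) (arctan_lt_pi_div_two (1 / n)) hθ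
    rwa [tan_arctan] at this
  rw [tan_eq_sin_div_cos, div_lt_div_iff₀ hc h0, one_mul] at htan
  have hK : 0 < cos (ω * (1 / n)) ^ 2 - n ^ 2 * sin (ω * (1 / n)) ^ 2 := by
    have : (sin (ω * (1 / n)) * n) ^ 2 < cos (ω * (1 / n)) ^ 2 := by gcongr
    linarith [mul_pow (sin (ω * (1 / n))) n 2]
  rw [Submodule.eq_bot_iff]
  intro f hf
  obtain ⟨T, A, f1, f2, f3, f4, f5⟩ := exists_of_mem_eigenspace hn hω.ne' hc.ne' hf
  set K := cos (ω * (1 / n)) ^ 2 - n ^ 2 * sin (ω * (1 / n)) ^ 2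
  set P := sin (ω * (1 / n)) * cos (ω * (1 / n)) * (1 + n ^ 2)
  have hP : 0 < P := by positivity
  -- Both `A s` are eliminated from the conditions at the centre; the remaining factor of `T` is
  -- positive.
  have e1 : T * (sin (ω * (1 - 2 / n)) * K + 2 * cos (ω * (1 - 2 / n)) * P) = 0 := by
    linear_combination K * f5 + P * f4 true + P * f4 false
  have hT : T = 0 := (mul_eq_zero.1 e1).resolve_right (by positivity)
  have hA : ∀ s, A s = 0 := fun s => by
    have := f4 s
    rw [hT, zero_mul] at this
    exact (mul_eq_zero.1 this.symm).resolve_right hK.ne'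
  funext p
  obtain ⟨e, x, hx, rfl⟩ := exists_pt_eq hn p
  rcases e with _ | ⟨s, _ | i⟩
  · simp [f1 x hx, hT]
  · simp [f2 s x hx, hA]
  · simp [f3 s i x hx, hA]

theorem eigenspace_eq_span :
    (doubleBroom n hn).eigenspace (frequency n ^ 2) = Submodule.span ℝ {mode hn} := by
  refine le_antisymm (fun f hf => ?_)
    ((Submodule.span_singleton_le_iff_mem _ _).2 (mode_mem_eigenspace hn))
  have h5 : (5 : ℝ) ≤ n := by exact_mod_cast hn
  have hd : (2 : ℝ) / n ≤ 1 := by rw [div_le_one] <;> linarith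
  have hL0 : 0 ≤ 1 - (2 : ℝ) / n := by linarith
  have hL1 : 1 - (2 : ℝ) / n ≤ 1 := by linarith [show (0 : ℝ) ≤ 2 / n by positivity]
  have hcL := cos_pos_of_le_frequency hn (frequency_pos hn).le le_rfl hL0 hL1
  have hc := cos_arctan_pos (1 / (n : ℝ))
  have hs := sin_arctan_pos.2 (show 0 < 1 / (n : ℝ) by positivity)
  obtain ⟨T, A, f1, f2, f3, f4, f5⟩ := exists_of_mem_eigenspace hn (frequency_pos hn).ne'
    (by rw [frequency_mul hn]; exact hc.ne') hf
  simp only [frequency_mul hn] at f2 f4 f5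
  -- At this frequency K = 0, so the tail must vanish at the centre, where its cosine is positive.
  have hT : T = 0 := by
    have := f4 true
    rw [cos_arctan_eq hn] at this
    exact (mul_eq_zero.1 (this.trans (by ring))).resolve_right hcL.ne'
  rw [hT, zero_mul, zero_add] at f5
  have hA : A false = - A true := by
    have := (mul_eq_zero.1 f5).resolve_right (by positivity)
    linarith
  have hA' : ∀ s, A s = A true * if s then 1 else -1 := by
    rintro (_ | _) <;> simp [hA]
  rw [Submodule.mem_span_singleton]
  refine ⟨A true, ?_⟩
  funext p
  obtain ⟨e, x, hx, rfl⟩ := exists_pt_eq hn p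
  rw [Pi.smul_apply, mode_pt hn e hx, smul_eq_mul]
  rcases e with _ | ⟨s, _ | i⟩
  · simp only [f1 x hx, hT, cosCoeff, sinCoeff]; ring
  · rw [f2 s x hx, hA' s]; simp only [cosCoeff, sinCoeff]; ring
  · rw [f3 s i x hx, hA' s]; simp only [cosCoeff, sinCoeff]; ring

/-! ### Location of the hot spots. -/

theorem abs_mode_le_and (p : (doubleBroom n hn).Point) : |mode hn p| ≤ 1 ∧
    (|mode hn p| = 1 → ∃ s i, p = .vertex (some (some (s, some i)))) := by
  have h0 : (0 : ℝ) < n := by positivity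
  have hc := cos_arctan_pos (1 / (n : ℝ))
  have hs := sin_arctan_pos.2 (show 0 < 1 / (n : ℝ) by positivity)
  have hf0 := frequency_pos hn
  have hsc := sin_sq_add_cos_sq (arctan (1 / (n : ℝ)))
  have hc1 : cos (arctan (1 / (n : ℝ))) < 1 := by nlinarith
  have hσ : ∀ s : Bool, |if s then (1 : ℝ) else -1| = 1 := by rintro (_ | _) <;> simp
  obtain ⟨e, x, hx, rfl⟩ := exists_pt_eq hn p
  rw [mode_pt hn e hx]
  rcases e with _ | ⟨s, _ | i⟩
  · simp [cosCoeff, sinCoeff]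
  · have hx0 : 0 ≤ frequency n * x := by have := hx.1; positivity
    have hx1 : frequency n * x ≤ arctan (1 / n) := by
      rw [← frequency_mul hn]; gcongr; exact hx.2
    have hπ := arctan_lt_pi_div_two (1 / (n : ℝ))
    have k1 : cos (arctan (1 / n)) ≤ cos (frequency n * x) :=
      cos_le_cos_of_nonneg_of_le_pi hx0 (by linarith [pi_pos]) hx1
    have k2 : sin (frequency n * x) ≤ sin (arctan (1 / n)) :=
      sin_le_sin_of_le_of_le_pi_div_two (by linarith [pi_pos]) hπ.le hx1
    have k3 : 0 ≤ sin (frequency n * x) :=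
      sin_nonneg_of_nonneg_of_le_pi hx0 (by linarith [pi_pos])
    have k4 := cos_le_one (frequency n * x)
    set c := cos (arctan (1 / (n : ℝ)))
    set t := sin (arctan (1 / (n : ℝ)))
    have hct : c = n * t := cos_arctan_eq hn
    have e1 : cosCoeff (some (s, none) : BroomEdge n) * cos (frequency n * x) +
        sinCoeff (some (s, none) : BroomEdge n) * sin (frequency n * x) =
        (if s then 1 else -1) * (c * cos (frequency n * x) - n * c * sin (frequency n * x)) := by
      simp only [cosCoeff, sinCoeff]
      linear_combination ((if s then 1 else -1) * n * sin (frequency n * x)) * hct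
    -- On the neck the first term lies in [c², c] and the second in [0, c²], so the difference lies
    -- in [0, c], and c < 1.
    have e2 : |c * cos (frequency n * x) - n * c * sin (frequency n * x)| < 1 := by
      have u1 : 0 ≤ n * c * sin (frequency n * x) := by positivity
      have u2 : n * c * sin (frequency n * x) ≤ n * c * t := by gcongr
      have u3 : c * c ≤ c * cos (frequency n * x) := by gcongr
      have u4 : c * cos (frequency n * x) ≤ c * 1 := by gcongr
      have u5 : n * c * t = c * c := by rw [hct]; ring
      rw [abs_lt]
      constructor <;> linarith
    rw [e1, abs_mul, hσ, one_mul]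
    exact ⟨e2.le, fun h => absurd h e2.ne⟩
  · have e1 : cosCoeff (some (s, some i)) * cos (frequency n * x) +
        sinCoeff (some (s, some i)) * sin (frequency n * x) =
        (if s then 1 else -1) * cos (frequency n * x) := by
      simp only [cosCoeff, sinCoeff]; ring
    rw [e1, abs_mul, hσ, one_mul]
    refine ⟨abs_cos_le_one _, fun h => ⟨s, i, ?_⟩⟩
    rcases hx.1.eq_or_lt with rfl | hx0
    · exact (doubleBroom n hn).pt_zero (some (s, some i))
    · have hx1 : frequency n * x ≤ arctan (1 / n) := by
        rw [← frequency_mul hn]; gcongr; exact hx.2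
      have hπ := arctan_lt_pi_div_two (1 / (n : ℝ))
      have h1 : 0 < frequency n * x := by positivity
      have h2 : 0 < cos (frequency n * x) := cos_pos_of_mem_Ioo ⟨by linarith, by linarith⟩
      have h3 := cos_lt_cos_of_nonneg_of_le_pi_div_two le_rfl (by linarith) h1
      rw [cos_zero, ← abs_of_pos h2, h] at h3
      exact absurd h3 (lt_irrefl _)

theorem mode_leaf (s : Bool) (i : Fin (n ^ 2)) :
    mode hn (.vertex (some (some (s, some i)))) = if s then 1 else -1 := rfl

theorem mode_ne_zero : mode hn ≠ 0 := by
  intro h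
  have := mode_leaf hn true ⟨0, by positivity⟩
  simp [h] at this

theorem isMu2 : (doubleBroom n hn).IsMu2 (frequency n ^ 2) := by
  have hf := frequency_pos hn
  refine ⟨⟨by positivity, fun h => mode_ne_zero hn ?_⟩, ?_⟩
  · have := mode_mem_eigenspace hn
    rwa [h, Submodule.mem_bot] at this
  · rintro lam ⟨h0, h⟩
    by_contra! hlt
    refine h ?_
    rw [← sq_sqrt h0.le]
    exact eigenspace_eq_bot hn (sqrt_pos.2 h0) ((sqrt_lt' hf).2 hlt)

theorem leaf_mem_hotSpots (i : Fin (n ^ 2)) :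
    .vertex (some (some (true, some i))) ∈ (doubleBroom n hn).hotSpots (frequency n ^ 2) :=
  ⟨mode hn, mode_mem_eigenspace hn, mode_ne_zero hn, fun y =>
    (le_abs_self _).trans ((abs_mode_le_and hn y).1.trans (mode_leaf hn true i).ge)⟩

theorem eq_leaf_of_mem_hotSpots {p : (doubleBroom n hn).Point}
    (hp : p ∈ (doubleBroom n hn).hotSpots (frequency n ^ 2)) :
    ∃ s i, p = .vertex (some (some (s, some i))) := by
  obtain ⟨f, hf, hf0, hmax⟩ := hp
  rw [eigenspace_eq_span, Submodule.mem_span_singleton] at hf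
  obtain ⟨a, rfl⟩ := hf
  have ha : a ≠ 0 := by rintro rfl; simp at hf0
  refine (abs_mode_le_and hn p).2 (le_antisymm (abs_mode_le_and hn p).1 ?_)
  -- The maximum is compared with the value at a leaf of the broom on which `mode` has the sign of
  -- `a`.
  have h1 : |a| ≤ a * mode hn p := by
    rcases le_total 0 a with h | h
    · have := hmax (.vertex (some (some (true, some ⟨0, by positivity⟩))))
      simpa [mode_leaf, abs_of_nonneg h] using this
    · have := hmax (.vertex (some (some (false, some ⟨0, by positivity⟩))))
      simpa [mode_leaf, abs_of_nonpos h] using this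
  have h2 := h1.trans (le_abs_self _)
  rw [abs_mul] at h2
  exact le_of_mul_le_mul_left (by simpa using h2) (abs_pos.2 ha)

theorem exists_isGreatest_dist_hotSpots : ∃ D : ℝ, IsGreatest
    {d : ℝ | ∃ x ∈ (doubleBroom n hn).hotSpots (frequency n ^ 2),
      ∃ y ∈ (doubleBroom n hn).hotSpots (frequency n ^ 2), d = (doubleBroom n hn).dist x y} D ∧
    D ≤ 4 / n := by
  -- Finiteness ensures that the largest distance between hot spots is attained.
  have hfin : ((doubleBroom n hn).hotSpots (frequency n ^ 2)).Finite := by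
    refine (finite_range fun q : Bool × Fin (n ^ 2) =>
      (.vertex (some (some (q.1, some q.2))) : (doubleBroom n hn).Point)).subset fun p hp => ?_
    obtain ⟨s, i, rfl⟩ := eq_leaf_of_mem_hotSpots hn hp
    exact ⟨(s, i), rfl⟩
  have hle : ∀ x ∈ (doubleBroom n hn).hotSpots (frequency n ^ 2),
      ∀ y ∈ (doubleBroom n hn).hotSpots (frequency n ^ 2),
      (doubleBroom n hn).dist x y ≤ 4 / n := by
    intro x hx y hy
    obtain ⟨s, i, rfl⟩ := eq_leaf_of_mem_hotSpots hn hx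
    obtain ⟨s', j, rfl⟩ := eq_leaf_of_mem_hotSpots hn hy
    have := dist_le_four_div hn (e := some (s, some i)) (e' := some (s', some j)) (by simp)
      (by simp) ⟨le_rfl, (length_pos hn _).le⟩ ⟨le_rfl, (length_pos hn _).le⟩
    rwa [MetricGraph.pt_zero, MetricGraph.pt_zero] at this
  have hS : {d : ℝ | ∃ x ∈ (doubleBroom n hn).hotSpots (frequency n ^ 2),
      ∃ y ∈ (doubleBroom n hn).hotSpots (frequency n ^ 2), d = (doubleBroom n hn).dist x y} =
      image2 (doubleBroom n hn).dist ((doubleBroom n hn).hotSpots (frequency n ^ 2))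
        ((doubleBroom n hn).hotSpots (frequency n ^ 2)) := by
    ext d
    simp only [mem_ofPred_eq, mem_image2, eq_comm]
  have hl := leaf_mem_hotSpots hn ⟨0, by positivity⟩
  rw [hS]
  obtain ⟨D, hD, hmax⟩ := exists_max_image _ (id : ℝ → ℝ) (hfin.image2 _ hfin) ⟨_, mem_image2_of_mem hl hl⟩
  refine ⟨D, ⟨hD, hmax⟩, ?_⟩
  obtain ⟨x, hx, y, hy, rfl⟩ := hD
  exact hle x hx y hy

end doubleBroom

theorem proposition4p7 (ε : ℝ) (hε : 0 < ε) :
    ∃ Γ : MetricGraph, Γ.IsTree ∧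
      IsGreatest {d : ℝ | ∃ x y : Γ.Point, d = Γ.dist x y} 1 ∧
      ∃ μ₂ : ℝ, Γ.IsMu2 μ₂ ∧
        Module.finrank ℝ (Γ.eigenspace μ₂) = 1 ∧
        ∃ D : ℝ, IsGreatest
          {d : ℝ | ∃ x ∈ Γ.hotSpots μ₂, ∃ y ∈ Γ.hotSpots μ₂, d = Γ.dist x y} D ∧ D < ε := by
  obtain ⟨m, hm⟩ := exists_nat_gt (4 / ε)
  have hn : 5 ≤ max 5 m := le_max_left _ _
  have hlt : (4 : ℝ) / (max 5 m : ℕ) < ε := by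
    have h1 : (m : ℝ) ≤ (max 5 m : ℕ) := by exact_mod_cast le_max_right _ _
    have h2 : (0 : ℝ) < (max 5 m : ℕ) := by positivity
    rw [div_lt_iff₀ hε] at hm
    rw [div_lt_iff₀ h2]
    nlinarith
  obtain ⟨D, hD, hle⟩ := doubleBroom.exists_isGreatest_dist_hotSpots hn
  refine ⟨doubleBroom _ hn, doubleBroom.isTree hn, doubleBroom.isGreatest_dist hn, _,
    doubleBroom.isMu2 hn, ?_, D, hD, hle.trans_lt hlt⟩
  rw [doubleBroom.eigenspace_eq_span]
  exact finrank_span_singleton (doubleBroom.mode_ne_zero hn)
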